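/- **Setting.** A dataset $D$ has a public number $n$ of rows with $k$ real-encoded attributes, each cell being either observed or missing. Two datasets of $n$ rows are neighbours if they differ in one row. A randomized algorithm $\mathcal M$ is $(\alpha,\varepsilon)$-RDP ($\alpha>1$) if $$\frac1{\alpha-1}\log \mathbb E_{x\sim \mathcal M(D')}\Big[\Big(\tfrac{P_D(x)}{P_{D'}(x)}\Big)^{\alpha}\Big]\le \varepsilon$$ for all neighbours $D,D'$, where $P_D$ is the law of $\mathcal M(D)$ and $P_D/P_{D'}$ is a Radon–Nikodym derivative; this requires $P_D\ll P_{D'}$. **DP-MisGAN.** There are two generator–discriminator pairs, one for data and one for missingness masks. In each pair the generator $G_\theta(z)\in\mathbb R^k$ and the discriminator $D_\varphi(x)\in\mathbb R$ are continuous, jointly in parameters and input; a gradient is read as $0$ where the function is not differentiable. The inputs are the number of epochs $E$, the batch size $1\le B\le n$, the generator interval $T_G\ge 1$, the noise scale $\sigma>0$ and real learning rates $\eta_D,\eta_G$. The initial parameters are drawn from an arbitrary law that does not depend on the dataset. In each of the $E$ epochs the dataset is shuffled uniformly and cut into $\lfloor n/B\rfloor$ disjoint batches $S_1,S_2,\dots$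 of $B$ rows. For $t=1,\dots,\lfloor n/B\rfloor$, each pair does the following with real examples $x_1,\dots,x_B$ (for the data pair, the rows of $S_t$ with missing cells set to $0$; for the mask pair, the masks of these rows, $1$ for missing and $0$ otherwise): 1. Draw $z_b\sim\mathcal N(0,I)$, put $y_b=G_\theta(z_b)$, and set $\varphi\leftarrow\varphi-\eta_D\nabla_\varphi\big[\tfrac1B\sum_b D_\varphi(x_b)-\tfrac1B\sum_b D_\varphi(y_b)\big]$. 2. If $T_G\mid t$: draw fresh $z'_b\sim\mathcal N(0,I)$ and $\xi\sim\mathcal N(0,I)$, put $g=\nabla_\theta\sum_b D_\varphi(G_\theta(z'_b))$, $\bar g=g/\max(1,\|g\|_2)$, $\tilde g=\bar g+2\sigma\xi$, and set $\theta\leftarrow\theta-\eta_G\tfrac1B\tilde g$. All random draws are independent. At the end the algorithm returns a synthetic dataset of $n$ rows $G_\theta(z_1),\dots,G_\theta(z_n)$, where $\theta$ is the final data generator and $z_1,\dots,z_n\sim\mathcal N(0,I)$ are fresh. Let $T=E\lfloor n/B\rfloor$ be the total number of training iterations. **Theorem.** For every integer $\alpha\ge2$, DP-MisGAN is $(\alpha,R(\alpha))$-RDP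 with $$R(\alpha)=2\Big\lceil\frac{T}{T_G}\Big\rceil\sum_{j=0}^{\alpha}\binom{\alpha}{j}\Big(1-\frac Bn\Big)^{\alpha-j}\Big(\frac Bn\Big)^{j}\exp\Big(\frac{\alpha^2-\alpha}{8\sigma^2}\Big).$$ Moreover, for every integer $\alpha\ge3$ the same bound holds if both trained generators (data and mask) are published together with the synthetic dataset. -/

import Mathlib

open MeasureTheory ProbabilityTheory

noncomputable section

/-! ### Rényi differential privacy -/

/-- Rényi divergence `D_α(P ‖ Q) = 1/(α-1) · log E_{x ∼ Q} [(P(x)/Q(x))^α]` of order `α > 1`,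
with values in the extended reals; it is `+∞` when `P` is not absolutely continuous with
respect to `Q`. -/
def renyiDivergence {Ω : Type*} [MeasurableSpace Ω] (α : ℝ) (P Q : Measure Ω) : EReal :=
  open Classical in
  if P ≪ Q then
    ((1 / (α - 1) : ℝ) : EReal) * ENNReal.log (∫⁻ x, (P.rnDeriv Q x) ^ α ∂Q)
  else ⊤

/-- Two datasets with the same number of rows are neighbours if they differ in (at most)
one row. -/
def Neighbour {n : ℕ} {Row : Type*} (D D' : Fin n → Row) : Prop :=
  ∃ i, ∀ j, j ≠ i → D j = D' j

/-- A randomized algorithm, given by the law `M D` of its output on each dataset `D`, is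
`(α, ε)`-RDP if `D_α(M D ‖ M D') ≤ ε` for all neighbouring `D`, `D'`. -/
def IsRDP {n : ℕ} {Row Ω : Type*} [MeasurableSpace Ω]
    (M : (Fin n → Row) → Measure Ω) (α ε : ℝ) : Prop :=
  ∀ D D', Neighbour D D' → renyiDivergence α (M D) (M D') ≤ (ε : EReal)

/-! ### Incomplete data -/

/-- Parameter vectors, latent vectors and encoded rows, with the Euclidean norm. -/
abbrev Vec (d : ℕ) := EuclideanSpace ℝ (Fin d)

/-- A row with `k` attributes; `none` marks a missing cell. -/
abbrev IncompleteRow (k : ℕ) := Fin k → Option ℝ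

/-- The row with its missing values filled with `0`. -/
def IncompleteRow.filled {k : ℕ} (r : IncompleteRow k) : Vec k :=
  WithLp.toLp 2 fun j => (r j).getD 0

/-- The row of the missing indicator matrix: `1` where the cell is missing, `0` otherwise. -/
def IncompleteRow.mask {k : ℕ} (r : IncompleteRow k) : Vec k :=
  WithLp.toLp 2 fun j => if (r j).isNone then 1 else 0

/-! ### One generator-discriminator pair -/

/-- The architecture of a generator-discriminator pair for vectors of length `k`:
`gen θ z` is the output of the generator with parameters `θ` on the latent vector `z`, and
`disc φ x` is the score that the discriminator with parameters `φ` gives to `x`. -/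
structure GANPair (k : ℕ) where
  genDim : ℕ
  discDim : ℕ
  latentDim : ℕ
  gen : Vec genDim → Vec latentDim → Vec k
  disc : Vec discDim → Vec k → ℝ
  gen_continuous : Continuous fun p : Vec genDim × Vec latentDim => gen p.1 p.2
  disc_continuous : Continuous fun p : Vec discDim × Vec k => disc p.1 p.2

/-- The parameters (generator, discriminator) of a pair. -/
abbrev GANPair.Params {k : ℕ} (P : GANPair k) := Vec P.genDim × Vec P.discDim

/-- The randomness that a pair uses in one iteration: a batch of latent vectors for the
discriminator update, a batch of latent vectors for the generator update, and the noise that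
is added to the clipped generator gradient. -/
abbrev GANPair.Noise {k : ℕ} (P : GANPair k) (B : ℕ) :=
  (Fin B → Vec P.latentDim) × (Fin B → Vec P.latentDim) × Vec P.genDim

/-- All of this randomness is independent standard Gaussian. -/
def GANPair.noiseLaw {k : ℕ} (P : GANPair k) (B : ℕ) : Measure (P.Noise B) :=
  (Measure.pi fun _ => stdGaussian (Vec P.latentDim)).prod
    ((Measure.pi fun _ => stdGaussian (Vec P.latentDim)).prod (stdGaussian (Vec P.genDim)))

/-- Clipping to norm at most one: `g / max (1, ‖g‖₂)`. -/
def clip {d : ℕ} (g : Vec d) : Vec d := (max 1 ‖g‖)⁻¹ • g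

/-- Hyperparameters: number of epochs `E`, batch size `B`, generator interval `T_G`,
noise scale `σ`, learning rates `η_D` and `η_G`. -/
structure HyperParams where
  epochs : ℕ
  batch : ℕ
  interval : ℕ
  noiseScale : ℝ
  discRate : ℝ
  genRate : ℝ

/-- The gradient step of the discriminator on the real batch `x` and the fake batch `y`. -/
def GANPair.discUpdate {k : ℕ} (P : GANPair k) (h : HyperParams) (x y : Fin h.batch → Vec k)
    (φ : Vec P.discDim) : Vec P.discDim :=
  φ - h.discRate • gradient (fun φ' =>
    (1 / (h.batch : ℝ)) * ∑ b, P.disc φ' (x b) - (1 / (h.batch : ℝ)) * ∑ b, P.disc φ' (y b)) φ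

/-- The gradient, in the generator parameters, of the discriminator's score of a batch of
generated examples. -/
def GANPair.genGradient {k : ℕ} (P : GANPair k) {B : ℕ} (φ : Vec P.discDim)
    (z : Fin B → Vec P.latentDim) (θ : Vec P.genDim) : Vec P.genDim :=
  gradient (fun θ' => ∑ b, P.disc φ (P.gen θ' (z b))) θ

/-- The private gradient step of the generator: clip, add `2σ` times the standard Gaussian
vector `ξ`, and descend. -/
def GANPair.genUpdate {k : ℕ} (P : GANPair k) (h : HyperParams) (φ : Vec P.discDim)
    (z : Fin h.batch → Vec P.latentDim) (ξ : Vec P.genDim) (θ : Vec P.genDim) : Vec P.genDim :=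
  θ - h.genRate • (1 / (h.batch : ℝ)) •
    (clip (P.genGradient φ z θ) + (2 * h.noiseScale) • ξ)

/-- One iteration for one pair on the real batch `x`: the discriminator is updated, and then,
if `u` holds, so is the generator, with the gradient given by the new discriminator. -/
def GANPair.step {k : ℕ} (P : GANPair k) (h : HyperParams) (u : Prop) [Decidable u]
    (x : Fin h.batch → Vec k) (w : P.Noise h.batch) (s : P.Params) : P.Params :=
  let φ := P.discUpdate h x (fun b => P.gen s.1 (w.1 b)) s.2
  (if u then P.genUpdate h φ w.2.1 w.2.2 s.1 else s.1, φ)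

/-! ### The training loop -/

/-- The architecture of DP-MisGAN: a pair for the data and a pair for the missingness masks. -/
structure MisGAN (k : ℕ) where
  data : GANPair k
  mask : GANPair k

namespace MisGAN

variable {k : ℕ} (N : MisGAN k)

/-- The parameters of the data pair and of the mask pair. -/
abbrev Params := N.data.Params × N.mask.Params

/-- The randomness of one iteration. -/
abbrev Noise (B : ℕ) := N.data.Noise B × N.mask.Noise B

theorem batch_index_lt {n B : ℕ} (t : Fin (n / B)) (b : Fin B) : t.1 * B + b.1 < n :=
  calc t.1 * B + b.1 < t.1 * B + B := Nat.add_lt_add_left b.2 _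
    _ = (t.1 + 1) * B := (Nat.succ_mul _ _).symm
    _ ≤ (n / B) * B := Nat.mul_le_mul_right _ t.2
    _ ≤ n := Nat.div_mul_le_self _ _

/-- The `t`-th batch of an epoch: the shuffled dataset is cut into consecutive disjoint
batches of `B` rows. -/
def batchRow {n : ℕ} {Row : Type*} (B : ℕ) (D : Fin n → Row) (π : Equiv.Perm (Fin n))
    (t : Fin (n / B)) (b : Fin B) : Row :=
  D (π ⟨t.1 * B + b.1, batch_index_lt t b⟩)

/-- One iteration of both pairs on the batch `S`; `u` says whether the generators are
updated. -/
def step (h : HyperParams) (u : Prop) [Decidable u] (S : Fin h.batch → IncompleteRow k)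
    (w : N.Noise h.batch) (s : N.Params) : N.Params :=
  (N.data.step h u (fun b => (S b).filled) w.1 s.1,
    N.mask.step h u (fun b => (S b).mask) w.2 s.2)

/-- One epoch: a pass over the `⌊n / B⌋` batches of the shuffled dataset. The iterations are
numbered `1, 2, …`, and the generators are updated in those whose number is a multiple of the
generator interval. -/
def epoch {n : ℕ} (h : HyperParams) (D : Fin n → IncompleteRow k) (π : Equiv.Perm (Fin n))
    (w : Fin (n / h.batch) → N.Noise h.batch) (s : N.Params) : N.Params :=
  (List.finRange (n / h.batch)).foldl
    (fun s t => N.step h (h.interval ∣ t.1 + 1) (batchRow h.batch D π t) (w t) s) s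

/-- The whole training. -/
def train {n : ℕ} (h : HyperParams) (D : Fin n → IncompleteRow k)
    (π : Fin h.epochs → Equiv.Perm (Fin n))
    (w : Fin h.epochs × Fin (n / h.batch) → N.Noise h.batch) (s : N.Params) : N.Params :=
  (List.finRange h.epochs).foldl (fun s i => N.epoch h D (π i) (fun t => w (i, t)) s) s

/-- All permutations are events. -/
instance permMeasurableSpace (n : ℕ) : MeasurableSpace (Equiv.Perm (Fin n)) := ⊤

/-- The randomness of a run: the initial parameters, the shuffle of each epoch, the randomness
of each iteration, and the latent vectors from which the synthetic rows are generated. -/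
abbrev Seed (n : ℕ) (h : HyperParams) :=
  N.Params × (Fin h.epochs → Equiv.Perm (Fin n)) ×
    (Fin h.epochs × Fin (n / h.batch) → N.Noise h.batch) × (Fin n → Vec N.data.latentDim)

/-- The initial parameters have law `init`, the shuffles are uniform, all other randomness is
standard Gaussian, and everything is independent. -/
def seedLaw (n : ℕ) (h : HyperParams) (init : Measure N.Params) : Measure (N.Seed n h) :=
  init.prod
    ((Measure.pi fun _ => uniformOn Set.univ).prod
      ((Measure.pi fun _ =>
          (N.data.noiseLaw h.batch).prod (N.mask.noiseLaw h.batch)).prod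
        (Measure.pi fun _ => stdGaussian (Vec N.data.latentDim))))

/-- The trained parameters. -/
def trained {n : ℕ} (h : HyperParams) (D : Fin n → IncompleteRow k) (ω : N.Seed n h) :
    N.Params :=
  N.train h D ω.2.1 ω.2.2.1 ω.1

/-- The synthetic dataset of `n` rows, generated by the trained data generator. -/
def synthetic {n : ℕ} (h : HyperParams) (D : Fin n → IncompleteRow k) (ω : N.Seed n h) :
    Fin n → Vec k :=
  fun i => N.data.gen (N.trained h D ω).1.1 (ω.2.2.2 i)

/-- DP-MisGAN: the law of the returned synthetic dataset. -/
def dpMisGAN (n : ℕ) (h : HyperParams) (init : Measure N.Params)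
    (D : Fin n → IncompleteRow k) : Measure (Fin n → Vec k) :=
  (N.seedLaw n h init).map (N.synthetic h D)

/-- DP-MisGAN with both trained generators published (the discriminators are thrown away):
the joint law of the data generator, the mask generator and the synthetic dataset. -/
def dpMisGANGenerators (n : ℕ) (h : HyperParams) (init : Measure N.Params)
    (D : Fin n → IncompleteRow k) :
    Measure (Vec N.data.genDim × Vec N.mask.genDim × (Fin n → Vec k)) :=
  (N.seedLaw n h init).map fun ω =>
    ((N.trained h D ω).1.1, (N.trained h D ω).2.1, N.synthetic h D ω)

end MisGAN

/-- The total number `T` of training iterations on a dataset with `n` rows. -/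
def HyperParams.iterations (h : HyperParams) (n : ℕ) : ℕ := h.epochs * (n / h.batch)

/-- The total cost
`R(α) = 2 ⌈T/T_G⌉ ∑_{k=0}^α C(α,k) (1 - B/n)^{α-k} (B/n)^k exp((α² - α)/(8σ²))`. -/
def dpMisGANCost (n : ℕ) (h : HyperParams) (α : ℕ) : ℝ :=
  2 * (⌈(h.iterations n : ℝ) / (h.interval : ℝ)⌉₊ : ℝ) *
    ∑ k ∈ Finset.range (α + 1),
      (α.choose k : ℝ) * (1 - (h.batch : ℝ) / n) ^ (α - k) * ((h.batch : ℝ) / n) ^ k *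
        Real.exp (((α : ℝ) ^ 2 - α) / (8 * h.noiseScale ^ 2))

end

noncomputable section

open scoped ENNReal

/-! ### The dual form of a Rényi divergence bound -/

/-! By Hölder duality, bounding the Rényi divergence of P from Q amounts to bounding the L^α(Q) norm
of dP/dQ by some K, that is, to E_P f ≤ K ‖f‖ in L^β(Q) for all measurable f ≥ 0. In this form
post-processing is free (`comp`), common independent randomness can be fixed (`mixture`), and
constants multiply under adaptive composition (`bind`, `foldl`), with no densities or conditional
laws to handle.

The only noisy step is the generator update. Two clipped gradients differ by at most 2 and the noise
has scale 2σ, so in units of the noise the shift is at most 1/σ, with constant K = exp((α-1)/(2σ²)).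
This holds for any two batches, so one may condition on the shuffles.

The obstacle is that the discriminators see the data without noise, so the states (θ, φ) of two runs
are not comparable. `coupledStep` therefore carries both discriminators, one per dataset, along a
single generator; the two versions differ only in which discriminator drives the generator. Given
the state and the latent vectors, both new discriminators are fixed and common, and only θ is
shifted. Forgetting the idle discriminator recovers the run on either dataset.

With m generator updates per pair the divergence is at most mα/(2σ²) per trained pair. The binomial
weights in R(α) sum to 1, so R(α) = 2⌈T/T_G⌉e^y with y = (α²-α)/(8σ²), and e^y ≥ 2y gives R(α) ≥
(α-1)·mα/(2σ²). This covers one pair when α ≥ 2 and two pairs when α ≥ 3. -/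

/-- The law of `A` is dominated by the law of `B` (both under `μ`), tested against nonnegative
functions in `L^β`. For the exponent `α` conjugate to `β` this is the dual form of
`E_Q[(dP/dQ)^α] ≤ K^α`, where `P` and `Q` are the two laws. -/
def HolderDominated {Ω S : Type*} [MeasurableSpace Ω] [MeasurableSpace S] (β : ℝ) (K : ℝ≥0∞)
    (μ : Measure Ω) (A B : Ω → S) : Prop :=
  ∀ f : S → ℝ≥0∞, Measurable f →
    ∫⁻ ω, f (A ω) ∂μ ≤ K * (∫⁻ ω, f (B ω) ^ β ∂μ) ^ (1 / β)

namespace HolderDominated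

variable {Ω Ω' S S' : Type*} [MeasurableSpace Ω] [MeasurableSpace Ω'] [MeasurableSpace S]
  [MeasurableSpace S'] {α β : ℝ} {K K' : ℝ≥0∞} {μ : Measure Ω} {ν : Measure Ω'}

theorem refl (hαβ : α.HolderConjugate β) [IsProbabilityMeasure μ] {A : Ω → S}
    (hA : Measurable A) : HolderDominated β 1 μ A A := by
  intro f hf
  -- Hölder against the constant 1, whose norm is 1 on a probability space.
  have h := ENNReal.lintegral_mul_le_Lp_mul_Lq μ hαβ (f := fun _ => 1) (g := fun ω => f (A ω))
    aemeasurable_const (hf.comp hA).aemeasurable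
  simpa using h

/-- Data processing: a test function on the image pulls back to one on the source. -/
theorem comp {A B : Ω → S} (h : HolderDominated β K μ A B) {g : S → S'} (hg : Measurable g) :
    HolderDominated β K μ (fun ω => g (A ω)) (fun ω => g (B ω)) :=
  fun f hf => h (fun s => f (g s)) (hf.comp hg)

theorem mono {A B : Ω → S} (h : HolderDominated β K μ A B) (hK : K ≤ K') :
    HolderDominated β K' μ A B :=
  fun f hf => (h f hf).trans (by gcongr)

theorem comp_measurePreserving_iff {A B : Ω → S} (hA : Measurable A) (hB : Measurable B)
    {g : Ω' → Ω} (hg : MeasurePreserving g ν μ) :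
    HolderDominated β K ν (fun ω => A (g ω)) (fun ω => B (g ω)) ↔ HolderDominated β K μ A B := by
  refine forall₂_congr fun f hf => ?_
  rw [hg.lintegral_comp (f := fun ω => f (A ω)) (hf.comp hA),
    hg.lintegral_comp (f := fun ω => f (B ω) ^ β) ((hf.comp hB).pow_const β)]

/-- Adaptive composition. -/
theorem bind (hβ : 0 < β) [SFinite μ] [SFinite ν] {A B : Ω → S} (hA : Measurable A)
    (hB : Measurable B) (h : HolderDominated β K μ A B) {A' B' : Ω' → S → S'}
    (hA' : Measurable fun p : Ω' × S => A' p.1 p.2)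
    (hB' : Measurable fun p : Ω' × S => B' p.1 p.2)
    (h' : ∀ s, HolderDominated β K' ν (fun x => A' x s) fun x => B' x s) :
    HolderDominated β (K * K') (μ.prod ν) (fun p => A' p.2 (A p.1)) fun p => B' p.2 (B p.1) := by
  intro f hf
  have mA : Measurable fun p : Ω × Ω' => f (A' p.2 (A p.1)) :=
    hf.comp (hA'.comp (measurable_snd.prodMk (hA.comp measurable_fst)))
  have mB : Measurable fun p : Ω × Ω' => f (B' p.2 (B p.1)) ^ β :=
    (hf.comp (hB'.comp (measurable_snd.prodMk (hB.comp measurable_fst)))).pow_const β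
  have mG : Measurable fun s => ∫⁻ x, f (B' x s) ^ β ∂ν :=
    Measurable.lintegral_prod_left ((hf.comp hB').pow_const β)
  rw [lintegral_prod _ mA.aemeasurable, lintegral_prod _ mB.aemeasurable]
  calc ∫⁻ ω, ∫⁻ x, f (A' x (A ω)) ∂ν ∂μ
      ≤ ∫⁻ ω, K' * (∫⁻ x, f (B' x (A ω)) ^ β ∂ν) ^ (1 / β) ∂μ :=
        lintegral_mono fun ω => h' (A ω) f hf
    -- The conditional L^β norm of `f` is itself the test function for the first stage.
    _ ≤ K * (∫⁻ ω, (K' * (∫⁻ x, f (B' x (B ω)) ^ β ∂ν) ^ (1 / β)) ^ β ∂μ) ^ (1 / β) :=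
        h (fun s => K' * (∫⁻ x, f (B' x s) ^ β ∂ν) ^ (1 / β)) ((mG.pow_const _).const_mul _)
    _ = K * K' * (∫⁻ ω, ∫⁻ x, f (B' x (B ω)) ^ β ∂ν ∂μ) ^ (1 / β) := by
        have e : ∀ ω, (K' * (∫⁻ x, f (B' x (B ω)) ^ β ∂ν) ^ (1 / β)) ^ β
            = K' ^ β * ∫⁻ x, f (B' x (B ω)) ^ β ∂ν := fun ω => by
          rw [ENNReal.mul_rpow_of_nonneg _ _ hβ.le, ← ENNReal.rpow_mul,
            one_div_mul_cancel hβ.ne', ENNReal.rpow_one]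
        simp_rw [e]
        rw [lintegral_const_mul (f := fun ω => ∫⁻ x, f (B' x (B ω)) ^ β ∂ν) _ (mG.comp hB),
          ENNReal.mul_rpow_of_nonneg _ _ (by positivity),
          ← ENNReal.rpow_mul, mul_one_div_cancel hβ.ne', ENNReal.rpow_one, mul_assoc]

/-- Domination given the value of some independent randomness. -/
theorem mixture (hαβ : α.HolderConjugate β) [IsProbabilityMeasure μ] [SFinite ν]
    {A B : Ω → Ω' → S} (hA : Measurable fun p : Ω × Ω' => A p.1 p.2)
    (hB : Measurable fun p : Ω × Ω' => B p.1 p.2)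
    (h : ∀ a, HolderDominated β K ν (A a) (B a)) :
    HolderDominated β K (μ.prod ν) (fun p => A p.1 p.2) fun p => B p.1 p.2 := by
  -- The fixed randomness acts as a first stage identical on both sides, with constant 1.
  have := bind hαβ.symm.pos measurable_id measurable_id (refl (μ := μ) hαβ measurable_id)
    (A' := fun x a => A a x) (B' := fun x a => B a x) (hA.comp measurable_swap)
    (hB.comp measurable_swap) h
  simpa using this

theorem prod_right (hαβ : α.HolderConjugate β) [SFinite μ] [IsProbabilityMeasure ν]
    {A B : Ω → S} (hA : Measurable A) (hB : Measurable B) (h : HolderDominated β K μ A B) :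
    HolderDominated β K (μ.prod ν) (fun p => (A p.1, p.2)) fun p => (B p.1, p.2) := by
  have := bind hαβ.symm.pos hA hB h (A' := fun x s => (s, x)) (B' := fun x s => (s, x))
    measurable_swap measurable_swap fun s => refl (μ := ν) hαβ (by fun_prop)
  simpa using this

theorem prodMap (hβ : 0 < β) [SFinite μ] [SFinite ν] {A B : Ω → S} {A' B' : Ω' → S'}
    (hA : Measurable A) (hB : Measurable B) (hA' : Measurable A') (hB' : Measurable B')
    (h : HolderDominated β K μ A B) (h' : HolderDominated β K' ν A' B') :
    HolderDominated β (K * K') (μ.prod ν) (fun p => (A p.1, A' p.2)) fun p => (B p.1, B' p.2) :=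
  bind hβ hA hB h (A' := fun x s => (s, A' x)) (B' := fun x s => (s, B' x))
    (by fun_prop) (by fun_prop) fun _ => h'.comp measurable_prodMk_left

end HolderDominated

/-- Resampling one coordinate preserves a product of probability measures. -/
theorem measurePreserving_update {ι X : Type*} [Fintype ι] [DecidableEq ι] [MeasurableSpace X]
    (γ : Measure X) [IsProbabilityMeasure γ] (i : ι) :
    MeasurePreserving (fun p : X × (ι → X) => Function.update p.2 i p.1)
      (γ.prod (Measure.pi fun _ => γ)) (Measure.pi fun _ => γ) := by
  have hm : Measurable fun p : X × (ι → X) => Function.update p.2 i p.1 :=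
    measurable_update'.comp measurable_swap
  refine ⟨hm, (Measure.pi_eq fun s hs => ?_).symm⟩
  rw [Measure.map_apply hm (MeasurableSet.univ_pi hs)]
  have : (fun p : X × (ι → X) => Function.update p.2 i p.1) ⁻¹' Set.univ.pi s
      = s i ×ˢ Set.univ.pi (Function.update s i Set.univ) := by
    ext ⟨x, w⟩
    simp only [Set.mem_preimage, Set.mem_pi, Set.mem_univ, true_implies, Set.mem_prod]
    constructor
    · refine fun h => ⟨by simpa using h i, fun j => ?_⟩
      by_cases hj : j = i
      · subst hj; simp
      · simpa [hj] using h j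
    · rintro ⟨h1, h2⟩ j
      by_cases hj : j = i
      · subst hj; simpa using h1
      · simpa [hj] using h2 j
  rw [this, Measure.prod_prod, Measure.pi_pi, ← Finset.mul_prod_erase _ _ (Finset.mem_univ i),
    ← Finset.mul_prod_erase _ _ (Finset.mem_univ i)]
  simp only [Function.update_self, measure_univ, one_mul]
  congr 1
  refine Finset.prod_congr rfl fun j hj => ?_
  rw [Function.update_of_ne (Finset.ne_of_mem_erase hj)]

/-! ### Composition along a list of steps -/

section Fold

variable {ι X S : Type*}

theorem measurable_foldl [MeasurableSpace X] [MeasurableSpace S] {A : ι → X → S → S}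
    (hA : ∀ i, Measurable fun p : X × S => A i p.1 p.2) (L : List ι) :
    Measurable fun p : (ι → X) × S => L.foldl (fun s i => A i (p.1 i) s) p.2 := by
  induction L with
  | nil => exact measurable_snd
  | cons i L ih =>
    have h : Measurable fun p : (ι → X) × S => (p.1, A i (p.1 i) p.2) :=
      measurable_fst.prodMk ((hA i).comp (g := fun p : X × S => A i p.1 p.2)
        (f := fun p : (ι → X) × S => (p.1 i, p.2)) (by fun_prop))
    exact ih.comp h

theorem foldl_update_of_notMem [DecidableEq ι] (A : ι → X → S → S) {i : ι} {L : List ι}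
    (hi : i ∉ L) (w : ι → X) (x : X) (s : S) :
    L.foldl (fun s j => A j (Function.update w i x j) s) s
      = L.foldl (fun s j => A j (w j) s) s := by
  refine List.foldl_ext _ _ _ fun s j hj => ?_
  rw [Function.update_of_ne (ne_of_mem_of_not_mem hj hi)]

/-- Composition of a sequence of steps with independent randomness. -/
theorem HolderDominated.foldl [MeasurableSpace X] [MeasurableSpace S] [Fintype ι]
    [DecidableEq ι] {α β : ℝ} (hαβ : α.HolderConjugate β) {γ : Measure X} [IsProbabilityMeasure γ] {A B : ι → X → S → S}
    (hA : ∀ i, Measurable fun p : X × S => A i p.1 p.2)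
    (hB : ∀ i, Measurable fun p : X × S => B i p.1 p.2) {K : ι → ℝ≥0∞}
    (h : ∀ i s, HolderDominated β (K i) γ (fun x => A i x s) fun x => B i x s)
    {L : List ι} (hL : L.Nodup) (s : S) :
    HolderDominated β (L.map K).prod (Measure.pi fun _ : ι => γ)
      (fun w => L.foldl (fun s i => A i (w i) s) s)
      fun w => L.foldl (fun s i => B i (w i) s) s := by
  induction L generalizing s with
  | nil => simpa using HolderDominated.refl hαβ measurable_const
  | cons i L ih =>
    obtain ⟨hi, hL⟩ := List.nodup_cons.1 hL
    have key := HolderDominated.bind hαβ.symm.pos ((hA i).comp measurable_prodMk_right)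
      ((hB i).comp measurable_prodMk_right) (h i s) (measurable_foldl hA L)
      (measurable_foldl hB L) (ih hL)
    -- After resampling coordinate `i`, step `i` reads the fresh draw and the tail reads only the
    -- others, since `i` does not recur.
    rw [List.map_cons, List.prod_cons, ← HolderDominated.comp_measurePreserving_iff
      (A := fun w => (i :: L).foldl (fun s i => A i (w i) s) s)
      (B := fun w => (i :: L).foldl (fun s i => B i (w i) s) s)
      ((measurable_foldl hA (i :: L)).comp measurable_prodMk_right)
      ((measurable_foldl hB (i :: L)).comp measurable_prodMk_right) (measurePreserving_update γ i)]
    simpa [foldl_update_of_notMem _ hi] using key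

end Fold

/-! ### From the dual form back to the Rényi divergence -/

/-- Converse Hölder: test with r^(α-1), where r = dP/dQ. Truncating r at N keeps the integral
finite, so that a power of it can be cancelled; monotone convergence removes N. -/
theorem lintegral_rnDeriv_rpow_le {Ω : Type*} [MeasurableSpace Ω] {P Q : Measure Ω}
    [IsProbabilityMeasure P] [IsProbabilityMeasure Q] {α β : ℝ} (hαβ : α.HolderConjugate β)
    {K : ℝ≥0∞} (hPQ : P ≪ Q) (h : ∀ f : Ω → ℝ≥0∞, Measurable f →
      ∫⁻ x, f x ∂P ≤ K * (∫⁻ x, f x ^ β ∂Q) ^ (1 / β)) :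
    ∫⁻ x, P.rnDeriv Q x ^ α ∂Q ≤ K ^ α := by
  have hα := hαβ.lt
  have hα0 := hαβ.pos
  have hr : Measurable (P.rnDeriv Q) := Measure.measurable_rnDeriv P Q
  have bound : ∀ N : ℕ, ∫⁻ x, min (P.rnDeriv Q x) N ^ α ∂Q ≤ K ^ α := by
    intro N
    set I := ∫⁻ x, min (P.rnDeriv Q x) N ^ α ∂Q with hI
    have mm : Measurable fun x => min (P.rnDeriv Q x) (N : ℝ≥0∞) := hr.min measurable_const
    have hfin : I ≠ ∞ := by
      refine ne_top_of_le_ne_top (b := (N : ℝ≥0∞) ^ α) (by finiteness) ?_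
      calc I ≤ ∫⁻ _, (N : ℝ≥0∞) ^ α ∂Q :=
            lintegral_mono fun x => ENNReal.rpow_le_rpow (min_le_right _ _) hα0.le
        _ = _ := by simp
    have h1 : I ≤ K * I ^ (1 / β) := by
      -- One of the α factors is relaxed to the untruncated density, which turns Q into P; then
      -- (α-1)β = α closes the loop.
      calc I ≤ ∫⁻ x, P.rnDeriv Q x * min (P.rnDeriv Q x) N ^ (α - 1) ∂Q := by
            refine lintegral_mono fun x => ?_
            have : min (P.rnDeriv Q x) (N : ℝ≥0∞) ^ α
                = min (P.rnDeriv Q x) N * min (P.rnDeriv Q x) N ^ (α - 1) := by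
              conv_lhs => rw [show α = 1 + (α - 1) by ring]
              rw [ENNReal.rpow_add_of_nonneg _ _ zero_le_one (by linarith), ENNReal.rpow_one]
            change min (P.rnDeriv Q x) (N : ℝ≥0∞) ^ α ≤ _
            rw [this]
            gcongr
            exact min_le_left _ _
        _ = ∫⁻ x, min (P.rnDeriv Q x) N ^ (α - 1) ∂P :=
            lintegral_rnDeriv_mul hPQ (mm.pow_const _).aemeasurable
        _ ≤ K * (∫⁻ x, (min (P.rnDeriv Q x) N ^ (α - 1)) ^ β ∂Q) ^ (1 / β) :=
            h _ (mm.pow_const _)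
        _ = K * I ^ (1 / β) := by
            simp_rw [← ENNReal.rpow_mul, hαβ.sub_one_mul_conj, hI]
    rcases eq_or_ne I 0 with h0 | h0
    · rw [h0]; exact zero_le
    have h2 : I ^ (1 / α) * I ^ (1 / β) ≤ K * I ^ (1 / β) := by
      rwa [← ENNReal.rpow_add _ _ h0 hfin, one_div, one_div, hαβ.inv_add_inv_eq_one,
        ENNReal.rpow_one, ← one_div]
    have hβ := hαβ.symm.pos
    have h3 : I ^ (1 / α) ≤ K := by
      refine (ENNReal.mul_le_mul_iff_left ?_ ?_).1 h2
      · exact (ENNReal.rpow_pos (pos_iff_ne_zero.2 h0) hfin).ne'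
      · exact ENNReal.rpow_ne_top_of_nonneg (by positivity) hfin
    calc I = (I ^ (1 / α)) ^ α := by
          rw [← ENNReal.rpow_mul, one_div_mul_cancel hα0.ne', ENNReal.rpow_one]
      _ ≤ K ^ α := ENNReal.rpow_le_rpow h3 hα0.le
  refine le_of_tendsto' (lintegral_tendsto_of_tendsto_of_monotone
    (f := fun (N : ℕ) x => min (P.rnDeriv Q x) (N : ℝ≥0∞) ^ α)
    (fun N => ((hr.min measurable_const).pow_const α).aemeasurable) ?_ ?_) bound
  · refine Filter.Eventually.of_forall fun x M N hMN => ?_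
    exact ENNReal.rpow_le_rpow (min_le_min le_rfl (by exact_mod_cast hMN)) hα0.le
  · refine Filter.Eventually.of_forall fun x => ?_
    have h1 : Filter.Tendsto (fun N : ℕ => min (P.rnDeriv Q x) (N : ℝ≥0∞)) Filter.atTop
        (nhds (min (P.rnDeriv Q x) ∞)) :=
      tendsto_const_nhds.min ENNReal.tendsto_nat_nhds_top
    rw [min_top_right] at h1
    exact (ENNReal.continuous_rpow_const.tendsto _).comp h1

theorem HolderDominated.renyiDivergence_le {Ω S : Type*} [MeasurableSpace Ω] [MeasurableSpace S]
    {α β : ℝ} (hαβ : α.HolderConjugate β) {κ : ℝ} {μ : Measure Ω} [IsProbabilityMeasure μ]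
    {A B : Ω → S} (hA : Measurable A) (hB : Measurable B)
    (h : HolderDominated β (ENNReal.ofReal (Real.exp κ)) μ A B) :
    renyiDivergence α (μ.map A) (μ.map B) ≤ ((1 / (α - 1) * (α * κ) : ℝ) : EReal) := by
  have hβ := hαβ.symm.pos
  have h' : ∀ f : S → ℝ≥0∞, Measurable f → ∫⁻ x, f x ∂(μ.map A)
      ≤ ENNReal.ofReal (Real.exp κ) * (∫⁻ x, f x ^ β ∂(μ.map B)) ^ (1 / β) := fun f hf => by
    rw [lintegral_map hf hA, lintegral_map (hf.pow_const β) hB]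
    exact h f hf
  -- Tested on indicators, which are unchanged by the power β, domination forces null sets to be
  -- null.
  have hac : μ.map A ≪ μ.map B := by
    refine Measure.AbsolutelyContinuous.mk fun s hs h0 => ?_
    have := h' (s.indicator 1) (measurable_one.indicator hs)
    have e : ∀ x, s.indicator (1 : S → ℝ≥0∞) x ^ β = s.indicator 1 x := fun x => by
      by_cases hx : x ∈ s <;> simp [hx, hβ]
    simp_rw [e] at this
    rw [lintegral_indicator_one hs, lintegral_indicator_one hs, h0,
      ENNReal.zero_rpow_of_pos (by positivity), mul_zero] at this
    exact le_antisymm this zero_le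
  have := Measure.isProbabilityMeasure_map (μ := μ) hA.aemeasurable
  have := Measure.isProbabilityMeasure_map (μ := μ) hB.aemeasurable
  rw [renyiDivergence, if_pos hac, EReal.coe_mul]
  refine mul_le_mul_of_nonneg_left ?_ 
    (EReal.coe_nonneg.2 (one_div_nonneg.2 hαβ.sub_one_pos.le))
  refine (ENNReal.log_le_log (lintegral_rnDeriv_rpow_le hαβ hac h')).trans ?_
  rw [ENNReal.log_rpow, ENNReal.log_ofReal_of_pos (Real.exp_pos _), Real.log_exp, EReal.coe_mul]

/-! ### Shifts of Gaussian measures -/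

/-- Complete the square: the exponential is the density of the shifted Gaussian. -/
theorem lintegral_gaussianReal_add (v : ℝ) {f : ℝ → ℝ≥0∞} (hf : Measurable f) :
    ∫⁻ x, f (x + v) ∂gaussianReal 0 1
      = ∫⁻ x, ENNReal.ofReal (Real.exp (v * x - v ^ 2 / 2)) * f x ∂gaussianReal 0 1 := by
  rw [← lintegral_map (f := f) (g := fun x => x + v) hf (by fun_prop), gaussianReal_map_add_const,
    zero_add, gaussianReal_of_var_ne_zero _ one_ne_zero, gaussianReal_of_var_ne_zero _ one_ne_zero,
    lintegral_withDensity_eq_lintegral_mul _ (measurable_gaussianPDF _ _) hf,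
    lintegral_withDensity_eq_lintegral_mul _ (measurable_gaussianPDF _ _) (by fun_prop)]
  refine lintegral_congr fun x => ?_
  simp only [Pi.mul_apply, gaussianPDF, ← mul_assoc]
  rw [← ENNReal.ofReal_mul (gaussianPDFReal_nonneg _ _ _)]
  congr 2
  simp only [gaussianPDFReal, NNReal.coe_one]
  rw [mul_assoc _ (Real.exp _), ← Real.exp_add]
  congr 2
  ring

/-- Hölder splits off the density; its L^α norm comes from the Gaussian moment generating function
at αv, with exponent (α²v²/2 - αv²/2)/α. -/
theorem HolderDominated.gaussianReal_add {α β : ℝ} (hαβ : α.HolderConjugate β) (v : ℝ) :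
    HolderDominated β (ENNReal.ofReal (Real.exp ((α - 1) * v ^ 2 / 2))) (gaussianReal 0 1)
      (fun x => x + v) fun x => x := by
  intro f hf
  have hα := hαβ.pos
  rw [lintegral_gaussianReal_add v hf]
  refine (ENNReal.lintegral_mul_le_Lp_mul_Lq _ hαβ (by fun_prop) hf.aemeasurable).trans_eq ?_
  congr 1
  have e : ∀ x : ℝ, ENNReal.ofReal (Real.exp (v * x - v ^ 2 / 2)) ^ α
      = ENNReal.ofReal (Real.exp (α * v * x) * Real.exp (-(α * v ^ 2 / 2))) := fun x => by
    rw [ENNReal.ofReal_rpow_of_pos (Real.exp_pos _), ← Real.exp_mul, ← Real.exp_add]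
    ring_nf
  simp_rw [e]
  have hint : Integrable (fun x => Real.exp (α * v * x)) (gaussianReal 0 1) :=
    integrable_exp_mul_gaussianReal _
  rw [← ofReal_integral_eq_lintegral_ofReal (hint.mul_const _)
    (Filter.Eventually.of_forall fun x => by positivity), integral_mul_const]
  have hm := congrFun (mgf_fun_id_gaussianReal (μ := 0) (v := 1)) (α * v)
  simp only [mgf] at hm
  rw [hm, ← Real.exp_add, ENNReal.ofReal_rpow_of_pos (Real.exp_pos _), ← Real.exp_mul]
  congr 2
  simp only [NNReal.coe_one]
  field_simp
  ring

theorem foldl_update_eq {ι X : Type*} [DecidableEq ι] (g s : ι → X) (L : List ι) :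
    L.foldl (fun s i => Function.update s i (g i)) s = fun j => if j ∈ L then g j else s j := by
  induction L generalizing s with
  | nil => simp
  | cons i L ih =>
    rw [List.foldl_cons, ih]
    ext j
    by_cases hj : j ∈ L
    · simp [hj]
    · by_cases hi : j = i
      · subst hi; simp [hj]
      · simp [hj, hi]

/-- The shift is made in d independent steps, each overwriting one coordinate, so the composition
bound adds the exponents. The initial vector is irrelevant because every coordinate is overwritten.
-/
theorem HolderDominated.pi_gaussianReal_add {α β : ℝ} (hαβ : α.HolderConjugate β) {d : ℕ}
    (v : Fin d → ℝ) :
    HolderDominated β (ENNReal.ofReal (Real.exp ((α - 1) * (∑ i, v i ^ 2) / 2)))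
      (Measure.pi fun _ : Fin d => gaussianReal 0 1) (fun x => x + v) fun x => x := by
  have hm : ∀ c : Fin d → ℝ, ∀ i : Fin d, Measurable fun p : ℝ × (Fin d → ℝ) =>
      Function.update p.2 i (p.1 + c i) := fun c i =>
    measurable_update'.comp (measurable_snd.prodMk (measurable_fst.add_const (c i)))
  have key := HolderDominated.foldl hαβ (γ := gaussianReal 0 1)
    (A := fun i x s => Function.update s i (x + v i))
    (B := fun i x s => Function.update s i (x + (0 : Fin d → ℝ) i)) (hm v) (hm 0)
    (K := fun i => ENNReal.ofReal (Real.exp ((α - 1) * v i ^ 2 / 2)))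
    (fun i s => by
      simpa using (HolderDominated.gaussianReal_add hαβ (v i)).comp (measurable_update s (a := i)))
    (List.nodup_finRange d) 0
  have hK : ((List.finRange d).map
      fun i => ENNReal.ofReal (Real.exp ((α - 1) * v i ^ 2 / 2))).prod
      = ENNReal.ofReal (Real.exp ((α - 1) * (∑ i, v i ^ 2) / 2)) := by
    rw [← List.ofFn_eq_map, List.prod_ofFn, ← ENNReal.ofReal_prod_of_nonneg
      fun i _ => (Real.exp_pos _).le, ← Real.exp_sum, ← Finset.sum_div, ← Finset.mul_sum]
  rw [hK] at key
  have e : ∀ (c w : Fin d → ℝ), (List.finRange d).foldl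
      (fun s i => Function.update s i (w i + c i)) 0 = w + c := fun c w => by
    rw [foldl_update_eq (fun i => w i + c i)]
    ext j
    simp
  simpa only [e, add_zero] using key

theorem HolderDominated.stdGaussian_add {α β : ℝ} (hαβ : α.HolderConjugate β) {d : ℕ}
    (v : Vec d) :
    HolderDominated β (ENNReal.ofReal (Real.exp ((α - 1) * ‖v‖ ^ 2 / 2))) (stdGaussian (Vec d))
      (fun x => x + v) fun x => x := by
  have hmp : MeasurePreserving (WithLp.toLp 2) (Measure.pi fun _ : Fin d => gaussianReal 0 1)
      (stdGaussian (Vec d)) := ⟨by fun_prop, map_pi_eq_stdGaussian⟩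
  rw [← HolderDominated.comp_measurePreserving_iff (by fun_prop) (by fun_prop) hmp,
    EuclideanSpace.norm_sq_eq]
  simpa using (HolderDominated.pi_gaussianReal_add hαβ (WithLp.ofLp v)).comp
    (g := WithLp.toLp 2) (by fun_prop)

/-! ### Measurability of the training step -/

/-- Joint continuity suffices: the derivative, read as 0 where it does not exist, is still jointly
measurable. -/
theorem measurable_gradient_with_param {X : Type*} [TopologicalSpace X] [MeasurableSpace X]
    [OpensMeasurableSpace X] {d : ℕ} {f : X → Vec d → ℝ}
    (hf : Continuous f.uncurry) :
    Measurable fun p : X × Vec d => gradient (f p.1) p.2 :=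
  (InnerProductSpace.toDual ℝ (Vec d)).symm.continuous.measurable.comp
    (measurable_fderiv_with_param ℝ hf)

theorem continuous_clip {d : ℕ} : Continuous (clip : Vec d → Vec d) :=
  ((continuous_const.max continuous_norm).inv₀ fun _ =>
    (zero_lt_one.trans_le (le_max_left _ _)).ne').smul continuous_id

theorem norm_clip_le_one {d : ℕ} (g : Vec d) : ‖clip g‖ ≤ 1 := by
  have h : 0 < max 1 ‖g‖ := zero_lt_one.trans_le (le_max_left _ _)
  rw [clip, norm_smul, norm_inv, Real.norm_of_nonneg h.le, inv_mul_le_iff₀ h, mul_one]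
  exact le_max_right _ _

namespace GANPair

variable {k : ℕ} (P : GANPair k) (h : HyperParams)

theorem measurable_gen {X : Type*} [MeasurableSpace X] {θ : X → Vec P.genDim}
    {z : X → Vec P.latentDim} (hθ : Measurable θ) (hz : Measurable z) :
    Measurable fun a => P.gen (θ a) (z a) :=
  P.gen_continuous.measurable.comp (hθ.prodMk hz)

theorem measurable_discUpdate (x : Fin h.batch → Vec k) :
    Measurable fun p : (Fin h.batch → Vec k) × Vec P.discDim => P.discUpdate h x p.1 p.2 := by
  have hc : Continuous (Function.uncurry fun (y : Fin h.batch → Vec k) (φ : Vec P.discDim) =>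
      (1 / (h.batch : ℝ)) * ∑ b, P.disc φ (x b) - (1 / (h.batch : ℝ)) * ∑ b, P.disc φ (y b)) := by
    refine (continuous_const.mul (continuous_finsetSum _ fun b _ => ?_)).sub
      (continuous_const.mul (continuous_finsetSum _ fun b _ => ?_))
    · exact P.disc_continuous.comp (continuous_snd.prodMk continuous_const)
    · exact P.disc_continuous.comp
        (continuous_snd.prodMk ((continuous_apply b).comp continuous_fst))
  exact measurable_snd.sub ((measurable_gradient_with_param hc).const_smul h.discRate)

theorem measurable_genGradient (B : ℕ) :
    Measurable fun p : (Vec P.discDim × (Fin B → Vec P.latentDim)) × Vec P.genDim =>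
      P.genGradient p.1.1 p.1.2 p.2 := by
  refine measurable_gradient_with_param
    (f := fun (a : Vec P.discDim × (Fin B → Vec P.latentDim)) θ =>
      ∑ b, P.disc a.1 (P.gen θ (a.2 b))) (continuous_finsetSum _ fun b _ => ?_)
  exact P.disc_continuous.comp ((continuous_fst.comp continuous_fst).prodMk
    (P.gen_continuous.comp (continuous_snd.prodMk
      ((continuous_apply b).comp (continuous_snd.comp continuous_fst)))))

theorem measurable_genUpdate {X : Type*} [MeasurableSpace X] {φ : X → Vec P.discDim}
    {z : X → Fin h.batch → Vec P.latentDim} {ξ θ : X → Vec P.genDim} (hφ : Measurable φ)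
    (hz : Measurable z) (hξ : Measurable ξ) (hθ : Measurable θ) :
    Measurable fun a => P.genUpdate h (φ a) (z a) (ξ a) (θ a) :=
  hθ.sub ((((continuous_clip.measurable.comp ((P.measurable_genGradient h.batch).comp
    ((hφ.prodMk hz).prodMk hθ))).add (hξ.const_smul (2 * h.noiseScale))).const_smul
      (1 / (h.batch : ℝ))).const_smul h.genRate)

/-! ### Two discriminators along one generator -/

/-- A generator with two discriminators, one for each of two datasets. -/
abbrev CoupledParams := Vec P.genDim × Vec P.discDim × Vec P.discDim

/-- The initial discriminator is common to both datasets. -/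
def diagonal (s : P.Params) : P.CoupledParams := (s.1, s.2, s.2)

/-- The generator and the second (`c = true`) or first (`c = false`) discriminator. -/
def side (c : Bool) (s : P.CoupledParams) : P.Params := (s.1, bif c then s.2.2 else s.2.1)

/-- One iteration with a discriminator for the real batch `x` and one for the real batch `x'`;
the generator follows the second (`c = true`) or the first (`c = false`). -/
def coupledStep (c : Bool) (u : Prop) [Decidable u] (x x' : Fin h.batch → Vec k)
    (w : P.Noise h.batch) (s : P.CoupledParams) : P.CoupledParams :=
  let φ := P.discUpdate h x (fun b => P.gen s.1 (w.1 b)) s.2.1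
  let φ' := P.discUpdate h x' (fun b => P.gen s.1 (w.1 b)) s.2.2
  (if u then P.genUpdate h (bif c then φ' else φ) w.2.1 w.2.2 s.1 else s.1, φ, φ')

variable (u : Prop) [Decidable u] (x x' : Fin h.batch → Vec k)

/-- The generator never reads the discriminator it does not follow, so forgetting that one leaves a
genuine iteration. -/
theorem side_coupledStep (c : Bool) (w : P.Noise h.batch) (s : P.CoupledParams) :
    P.side c (P.coupledStep h c u x x' w s)
      = P.step h u (bif c then x' else x) w (P.side c s) := by
  cases c <;> rfl

theorem measurable_diagonal : Measurable P.diagonal :=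
  measurable_fst.prodMk (measurable_snd.prodMk measurable_snd)

theorem measurable_side (c : Bool) : Measurable (P.side c) := by
  cases c
  · exact measurable_fst.prodMk (measurable_fst.comp measurable_snd)
  · exact measurable_fst.prodMk (measurable_snd.comp measurable_snd)

theorem measurable_coupledStep (c : Bool) :
    Measurable fun p : P.Noise h.batch × P.CoupledParams =>
      P.coupledStep h c u x x' p.1 p.2 := by
  have hy : Measurable fun (p : P.Noise h.batch × P.CoupledParams) b =>
      P.gen p.2.1 (p.1.1 b) :=
    measurable_pi_lambda _ fun b => P.measurable_gen (by fun_prop) (by fun_prop)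
  have hφ : Measurable fun p : P.Noise h.batch × P.CoupledParams =>
      P.discUpdate h x (fun b => P.gen p.2.1 (p.1.1 b)) p.2.2.1 :=
    (P.measurable_discUpdate h x).comp (hy.prodMk (by fun_prop))
  have hφ' : Measurable fun p : P.Noise h.batch × P.CoupledParams =>
      P.discUpdate h x' (fun b => P.gen p.2.1 (p.1.1 b)) p.2.2.2 :=
    (P.measurable_discUpdate h x').comp (hy.prodMk (by fun_prop))
  refine Measurable.prodMk ?_ (hφ.prodMk hφ')
  split_ifs
  · cases c
    · exact P.measurable_genUpdate h hφ (by fun_prop) (by fun_prop) (by fun_prop)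
    · exact P.measurable_genUpdate h hφ' (by fun_prop) (by fun_prop) (by fun_prop)
  · fun_prop

/-! ### The cost of one iteration -/

instance (B : ℕ) : IsProbabilityMeasure (P.noiseLaw B) := by
  unfold noiseLaw; infer_instance

variable {α β : ℝ}

/-- The Gaussian mechanism: clipped gradients differ by at most `2`, and the noise has standard
deviation `2σ` in every direction. -/
theorem holderDominated_genUpdate (hαβ : α.HolderConjugate β) (hσ : 0 < h.noiseScale)
    (φ φ' : Vec P.discDim) (z : Fin h.batch → Vec P.latentDim) (θ : Vec P.genDim) :
    HolderDominated β (ENNReal.ofReal (Real.exp ((α - 1) / (2 * h.noiseScale ^ 2))))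
      (stdGaussian (Vec P.genDim)) (fun ξ => P.genUpdate h φ z ξ θ)
      fun ξ => P.genUpdate h φ' z ξ θ := by
  set σ := h.noiseScale
  set a := clip (P.genGradient φ z θ) with ha
  set b := clip (P.genGradient φ' z θ) with hb
  -- The difference of clipped gradients in units of the noise: shifting `ξ` by `v` turns the update
  -- for `φ'` into the one for `φ`. The scaling by the learning rate and batch size is
  -- post-processing.
  set v := (2 * σ)⁻¹ • (a - b) with hv
  have hv1 : ‖v‖ ≤ σ⁻¹ := by
    have : ‖a - b‖ ≤ 2 := (norm_sub_le a b).trans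
      (by linarith [norm_clip_le_one (P.genGradient φ z θ),
        norm_clip_le_one (P.genGradient φ' z θ)])
    rw [hv, norm_smul, Real.norm_of_nonneg (by positivity), inv_mul_le_iff₀ (by positivity)]
    exact this.trans_eq (by field_simp)
  have key := ((HolderDominated.stdGaussian_add hαβ v).comp
    (P.measurable_genUpdate h (φ := fun _ => φ') (z := fun _ => z) (ξ := id) (θ := fun _ => θ)
      measurable_const measurable_const measurable_id measurable_const)).mono
    (K' := ENNReal.ofReal (Real.exp ((α - 1) / (2 * σ ^ 2)))) (by
      refine ENNReal.ofReal_le_ofReal (Real.exp_le_exp.2 ?_)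
      have h2 : ‖v‖ ^ 2 ≤ (σ⁻¹) ^ 2 := by gcongr
      calc (α - 1) * ‖v‖ ^ 2 / 2 ≤ (α - 1) * (σ⁻¹) ^ 2 / 2 := by
            have := hαβ.sub_one_pos
            gcongr
        _ = _ := by field_simp)
  have e : ∀ ξ, P.genUpdate h φ' z (ξ + v) θ = P.genUpdate h φ z ξ θ := fun ξ => by
    have : (2 * σ) • v = a - b := by rw [hv, smul_inv_smul₀ (by positivity)]
    change θ - h.genRate • (1 / (h.batch : ℝ)) • (b + (2 * σ) • (ξ + v))
      = θ - h.genRate • (1 / (h.batch : ℝ)) • (a + (2 * σ) • ξ)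
    rw [smul_add (2 * σ), this]
    congr 3
    abel
  simpa only [id, e] using key

/-- Once both batches of latent vectors are fixed, the two new discriminators are constants shared
by both versions, and the Gaussian mechanism handles θ. Without a generator update the versions
coincide. -/
theorem holderDominated_coupledStep (hαβ : α.HolderConjugate β) (hσ : 0 < h.noiseScale)
    (s : P.CoupledParams) :
    HolderDominated β
      (ENNReal.ofReal (Real.exp (if u then (α - 1) / (2 * h.noiseScale ^ 2) else 0)))
      (P.noiseLaw h.batch) (fun w => P.coupledStep h false u x x' w s)
      fun w => P.coupledStep h true u x x' w s := by
  have hm : ∀ c, Measurable fun w => P.coupledStep h c u x x' w s :=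
    fun c => (P.measurable_coupledStep h u x x' c).comp measurable_prodMk_right
  by_cases hu : u
  · rw [if_pos hu]
    refine HolderDominated.mixture hαβ (A := fun z w => P.coupledStep h false u x x' (z, w) s)
      (B := fun z w => P.coupledStep h true u x x' (z, w) s) (hm false) (hm true) fun z => ?_
    refine HolderDominated.mixture hαβ
      (A := fun z' ξ => P.coupledStep h false u x x' (z, z', ξ) s)
      (B := fun z' ξ => P.coupledStep h true u x x' (z, z', ξ) s)
      ((hm false).comp measurable_prodMk_left) ((hm true).comp measurable_prodMk_left) fun z' => ?_
    simp only [coupledStep, if_pos hu, cond_false, cond_true]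
    exact (P.holderDominated_genUpdate h hαβ hσ _ _ z' s.1).comp
      (g := fun θ => (θ, P.discUpdate h x (fun b => P.gen s.1 (z b)) s.2.1,
        P.discUpdate h x' (fun b => P.gen s.1 (z b)) s.2.2)) measurable_prodMk_right
  · have e : (fun w => P.coupledStep h false u x x' w s)
        = fun w => P.coupledStep h true u x x' w s := by
      funext w
      simp only [coupledStep, if_neg hu]
    rw [if_neg hu, Real.exp_zero, ENNReal.ofReal_one, e]
    exact HolderDominated.refl hαβ (hm true)

end GANPair

/-! ### The training loop -/

namespace MisGAN

variable {k : ℕ} (N : MisGAN k) {n : ℕ} (h : HyperParams)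

/-- The iterations of a run in their order: epoch and position in the epoch. -/
def schedule (n : ℕ) : List (Fin h.epochs × Fin (n / h.batch)) :=
  List.finRange h.epochs ×ˢ List.finRange (n / h.batch)

theorem nodup_schedule : (schedule h n).Nodup :=
  (List.nodup_finRange _).product (List.nodup_finRange _)

theorem train_eq_foldl (D : Fin n → IncompleteRow k) (π : Fin h.epochs → Equiv.Perm (Fin n))
    (w : Fin h.epochs × Fin (n / h.batch) → N.Noise h.batch) (s : N.Params) :
    N.train h D π w s = (schedule h n).foldl (fun s e =>
      N.step h (h.interval ∣ e.2.1 + 1) (batchRow h.batch D (π e.1) e.2) (w e) s) s := by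
  simp only [train, epoch, schedule, SProd.sprod, List.product, List.foldl_flatMap, List.foldl_map]

/-- The iteration counter restarts in each epoch, so each epoch contributes ⌊⌊n/B⌋/T_G⌋ updates. -/
theorem prod_schedule (κ : ℝ) :
    ((schedule h n).map fun e =>
      ENNReal.ofReal (Real.exp (if h.interval ∣ e.2.1 + 1 then κ else 0))).prod
      = ENNReal.ofReal (Real.exp ((h.epochs * (n / h.batch / h.interval) : ℕ) * κ)) := by
  have hu : (schedule h n).toFinset = Finset.univ := by
    ext ⟨i, t⟩; simp [schedule, SProd.sprod, List.product]
  rw [← List.prod_toFinset _ (nodup_schedule h), hu,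
    ← ENNReal.ofReal_prod_of_nonneg fun _ _ => (Real.exp_pos _).le, ← Real.exp_sum,
    Fintype.sum_prod_type]
  have hs : ∑ t : Fin (n / h.batch), (if h.interval ∣ t.1 + 1 then κ else 0)
      = (n / h.batch / h.interval : ℕ) * κ := by
    rw [Fin.sum_univ_eq_sum_range (fun t => if h.interval ∣ t + 1 then κ else 0),
      ← Finset.sum_filter, Finset.sum_const, Nat.card_multiples, nsmul_eq_mul]
  simp only [hs, Finset.sum_const, Finset.card_univ, Fintype.card_fin, nsmul_eq_mul, Nat.cast_mul,
    mul_assoc]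

theorem measurable_run {S : Type*} [MeasurableSpace S] {s₀ : N.Params → S} (hs₀ : Measurable s₀)
    {A : (Fin h.epochs → Equiv.Perm (Fin n)) → Fin h.epochs × Fin (n / h.batch) →
      N.Noise h.batch → S → S}
    (hA : ∀ π e, Measurable fun p : N.Noise h.batch × S => A π e p.1 p.2) :
    Measurable fun ω : N.Seed n h =>
      ((schedule h n).foldl (fun s e => A ω.2.1 e (ω.2.2.1 e) s) (s₀ ω.1), ω.2.2.2) := by
  have : MeasurableSingletonClass (Equiv.Perm (Fin n)) := ⟨fun _ => trivial⟩
  have hF : Measurable fun p : (Fin h.epochs → Equiv.Perm (Fin n)) ×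
      ((Fin h.epochs × Fin (n / h.batch) → N.Noise h.batch) × S) =>
      (schedule h n).foldl (fun s e => A p.1 e (p.2.1 e) s) p.2.2 :=
    -- There are only finitely many shuffles, so measurability for each one suffices.
    measurable_from_prod_countable_right fun π => measurable_foldl (hA π) _
  refine Measurable.prodMk (hF.comp (f := fun ω : N.Seed n h => (ω.2.1, ω.2.2.1, s₀ ω.1)) ?_)
    (by fun_prop)
  fun_prop

/-- Composition over a whole run of two training procedures that use the same randomness. -/
theorem holderDominated_run {α β κ : ℝ} (hαβ : α.HolderConjugate β) (init : Measure N.Params)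
    [IsProbabilityMeasure init] {S : Type*} [MeasurableSpace S] {s₀ : N.Params → S}
    (hs₀ : Measurable s₀)
    {A B : (Fin h.epochs → Equiv.Perm (Fin n)) → Fin h.epochs × Fin (n / h.batch) →
      N.Noise h.batch → S → S}
    (hA : ∀ π e, Measurable fun p : N.Noise h.batch × S => A π e p.1 p.2)
    (hB : ∀ π e, Measurable fun p : N.Noise h.batch × S => B π e p.1 p.2)
    (hAB : ∀ π e s, HolderDominated β
      (ENNReal.ofReal (Real.exp (if h.interval ∣ e.2.1 + 1 then κ else 0)))
      ((N.data.noiseLaw h.batch).prod (N.mask.noiseLaw h.batch))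
      (fun w => A π e w s) fun w => B π e w s) :
    HolderDominated β
      (ENNReal.ofReal (Real.exp ((h.epochs * (n / h.batch / h.interval) : ℕ) * κ)))
      (N.seedLaw n h init)
      (fun ω => ((schedule h n).foldl (fun s e => A ω.2.1 e (ω.2.2.1 e) s) (s₀ ω.1), ω.2.2.2))
      fun ω => ((schedule h n).foldl (fun s e => B ω.2.1 e (ω.2.2.1 e) s) (s₀ ω.1), ω.2.2.2) := by
  have : MeasurableSingletonClass (Equiv.Perm (Fin n)) := ⟨fun _ => trivial⟩
  -- Condition on the initial parameters, then on the shuffles; the final latent vectors are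
  -- adjoined at no cost.
  refine HolderDominated.mixture hαβ
    (A := fun s (ω : (Fin h.epochs → Equiv.Perm (Fin n)) ×
        (Fin h.epochs × Fin (n / h.batch) → N.Noise h.batch) × (Fin n → Vec N.data.latentDim)) =>
      ((schedule h n).foldl (fun s e => A ω.1 e (ω.2.1 e) s) (s₀ s), ω.2.2))
    (B := fun s (ω : (Fin h.epochs → Equiv.Perm (Fin n)) ×
        (Fin h.epochs × Fin (n / h.batch) → N.Noise h.batch) × (Fin n → Vec N.data.latentDim)) =>
      ((schedule h n).foldl (fun s e => B ω.1 e (ω.2.1 e) s) (s₀ s), ω.2.2))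
    (N.measurable_run h hs₀ hA) (N.measurable_run h hs₀ hB) fun s => ?_
  refine HolderDominated.mixture hαβ
    (A := fun π (ω : (Fin h.epochs × Fin (n / h.batch) → N.Noise h.batch) ×
        (Fin n → Vec N.data.latentDim)) =>
      ((schedule h n).foldl (fun s e => A π e (ω.1 e) s) (s₀ s), ω.2))
    (B := fun π (ω : (Fin h.epochs × Fin (n / h.batch) → N.Noise h.batch) ×
        (Fin n → Vec N.data.latentDim)) =>
      ((schedule h n).foldl (fun s e => B π e (ω.1 e) s) (s₀ s), ω.2))
    ((N.measurable_run h hs₀ hA).comp measurable_prodMk_left)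
    ((N.measurable_run h hs₀ hB).comp measurable_prodMk_left) fun π => ?_
  refine HolderDominated.prod_right hαβ
    ((measurable_foldl (hA π) (schedule h n)).comp measurable_prodMk_right)
    ((measurable_foldl (hB π) (schedule h n)).comp measurable_prodMk_right) ?_
  rw [← prod_schedule]
  exact HolderDominated.foldl hαβ (hA π) (hB π) (hAB π) (nodup_schedule h) (s₀ s)

/-- The coupled iteration of the data pair on the batches of two datasets. -/
def dataStep (c : Bool) (D D' : Fin n → IncompleteRow k)
    (π : Fin h.epochs → Equiv.Perm (Fin n)) (e : Fin h.epochs × Fin (n / h.batch))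
    (w : N.data.Noise h.batch) (s : N.data.CoupledParams) : N.data.CoupledParams :=
  N.data.coupledStep h c (h.interval ∣ e.2.1 + 1)
    (fun b => (batchRow h.batch D (π e.1) e.2 b).filled)
    (fun b => (batchRow h.batch D' (π e.1) e.2 b).filled) w s

/-- The coupled iteration of the mask pair on the batches of two datasets. -/
def maskStep (c : Bool) (D D' : Fin n → IncompleteRow k)
    (π : Fin h.epochs → Equiv.Perm (Fin n)) (e : Fin h.epochs × Fin (n / h.batch))
    (w : N.mask.Noise h.batch) (s : N.mask.CoupledParams) : N.mask.CoupledParams :=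
  N.mask.coupledStep h c (h.interval ∣ e.2.1 + 1)
    (fun b => (batchRow h.batch D (π e.1) e.2 b).mask)
    (fun b => (batchRow h.batch D' (π e.1) e.2 b).mask) w s

variable (D D' : Fin n → IncompleteRow k)

/-! ### From coupled runs to the actual training -/

theorem side_foldl_dataStep (c : Bool) (π : Fin h.epochs → Equiv.Perm (Fin n))
    (w : Fin h.epochs × Fin (n / h.batch) → N.Noise h.batch) (s : N.Params) :
    N.data.side c ((schedule h n).foldl (fun s e => N.dataStep h c D D' π e (w e).1 s)
      (N.data.diagonal s.1)) = (N.train h (bif c then D' else D) π w s).1 := by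
  have h0 : N.data.side c (N.data.diagonal s.1) = s.1 := by cases c <;> rfl
  rw [train_eq_foldl, ← List.foldl_hom (N.data.side c) (g₂ := fun s e =>
    N.data.step h (h.interval ∣ e.2.1 + 1)
      (fun b => (batchRow h.batch (bif c then D' else D) (π e.1) e.2 b).filled) (w e).1 s), h0]
  · exact List.foldl_hom Prod.fst fun s e => rfl
  · intro s e
    rw [dataStep, GANPair.side_coupledStep]
    cases c <;> rfl

theorem side_foldl_dataStep_maskStep (c : Bool) (π : Fin h.epochs → Equiv.Perm (Fin n))
    (w : Fin h.epochs × Fin (n / h.batch) → N.Noise h.batch) (s : N.Params) :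
    Prod.map (N.data.side c) (N.mask.side c) ((schedule h n).foldl
      (fun s e => (N.dataStep h c D D' π e (w e).1 s.1, N.maskStep h c D D' π e (w e).2 s.2))
      (N.data.diagonal s.1, N.mask.diagonal s.2)) = N.train h (bif c then D' else D) π w s := by
  have h0 : Prod.map (N.data.side c) (N.mask.side c) (N.data.diagonal s.1, N.mask.diagonal s.2)
      = s := by cases c <;> rfl
  rw [train_eq_foldl, ← List.foldl_hom (Prod.map (N.data.side c) (N.mask.side c))
    (g₂ := fun s e => N.step h (h.interval ∣ e.2.1 + 1)
      (batchRow h.batch (bif c then D' else D) (π e.1) e.2) (w e) s), h0]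
  intro s e
  simp only [Prod.map]
  rw [dataStep, maskStep, GANPair.side_coupledStep, GANPair.side_coupledStep]
  cases c <;> rfl

theorem measurable_dataStep_maskStep (c : Bool) (π : Fin h.epochs → Equiv.Perm (Fin n))
    (e : Fin h.epochs × Fin (n / h.batch)) :
    Measurable fun p : N.Noise h.batch × N.data.CoupledParams × N.mask.CoupledParams =>
      (N.dataStep h c D D' π e p.1.1 p.2.1, N.maskStep h c D D' π e p.1.2 p.2.2) :=
  ((N.data.measurable_coupledStep h _ _ _ c).comp
    (f := fun p : N.Noise h.batch × N.data.CoupledParams × N.mask.CoupledParams =>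
      (p.1.1, p.2.1)) (by fun_prop)).prodMk ((N.mask.measurable_coupledStep h _ _ _ c).comp
    (f := fun p : N.Noise h.batch × N.data.CoupledParams × N.mask.CoupledParams =>
      (p.1.2, p.2.2)) (by fun_prop))

theorem measurable_trained :
    Measurable fun ω : N.Seed n h =>
      (((N.trained h D ω).1.1, (N.trained h D ω).2.1), ω.2.2.2) := by
  -- Training on `D` is the coupled run with both datasets equal to `D`.
  have key := (N.measurable_run h (s₀ := fun s => (N.data.diagonal s.1, N.mask.diagonal s.2))
    (((N.data.measurable_diagonal).comp measurable_fst).prodMk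
      ((N.mask.measurable_diagonal).comp measurable_snd))
    (A := fun π e w s => (N.dataStep h false D D π e w.1 s.1, N.maskStep h false D D π e w.2 s.2))
    (N.measurable_dataStep_maskStep h D D false))
  have := ((((N.data.measurable_side false).prodMap (N.mask.measurable_side false)).comp
    key.fst)).prodMk key.snd
  simp only [Function.comp_def, side_foldl_dataStep_maskStep, cond_false] at this
  exact Measurable.prodMk (Measurable.prodMk this.fst.fst.fst this.fst.snd.fst) this.snd

variable {α β : ℝ} (init : Measure N.Params) [IsProbabilityMeasure init]

/-- The data pair evolves without reading the mask pair, so only its own updates are charged; the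
mask noise is projected away. -/
theorem holderDominated_data (hαβ : α.HolderConjugate β) (hσ : 0 < h.noiseScale) :
    HolderDominated β (ENNReal.ofReal (Real.exp ((h.epochs * (n / h.batch / h.interval) : ℕ) *
      ((α - 1) / (2 * h.noiseScale ^ 2))))) (N.seedLaw n h init)
      (fun ω => ((N.trained h D ω).1.1, ω.2.2.2)) fun ω => ((N.trained h D' ω).1.1, ω.2.2.2) := by
  have key := (N.holderDominated_run h hαβ init (s₀ := fun s => N.data.diagonal s.1)
    ((N.data.measurable_diagonal).comp measurable_fst)
    (A := fun π e w s => N.dataStep h false D D' π e w.1 s)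
    (B := fun π e w s => N.dataStep h true D D' π e w.1 s)
    (fun π e => (N.data.measurable_coupledStep h _ _ _ false).comp
      (f := fun p : N.Noise h.batch × N.data.CoupledParams => (p.1.1, p.2)) (by fun_prop))
    (fun π e => (N.data.measurable_coupledStep h _ _ _ true).comp
      (f := fun p : N.Noise h.batch × N.data.CoupledParams => (p.1.1, p.2)) (by fun_prop))
    (fun π e s => (HolderDominated.comp_measurePreserving_iff
      ((N.data.measurable_coupledStep h _ _ _ false).comp measurable_prodMk_right)
      ((N.data.measurable_coupledStep h _ _ _ true).comp measurable_prodMk_right)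
      measurePreserving_fst).2 (N.data.holderDominated_coupledStep h _ _ _ hαβ hσ s))).comp
    (g := fun p => (p.1.1, p.2)) (by fun_prop)
  have e := fun c (ω : N.Seed n h) =>
    congrArg Prod.fst (N.side_foldl_dataStep h D D' c ω.2.1 ω.2.2.1 ω.1)
  simp only [GANPair.side] at e
  simpa only [e, trained, cond_false, cond_true] using key

theorem holderDominated_data_mask (hαβ : α.HolderConjugate β) (hσ : 0 < h.noiseScale) :
    HolderDominated β (ENNReal.ofReal (Real.exp ((h.epochs * (n / h.batch / h.interval) : ℕ) *
      (2 * ((α - 1) / (2 * h.noiseScale ^ 2)))))) (N.seedLaw n h init)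
      (fun ω => (((N.trained h D ω).1.1, (N.trained h D ω).2.1), ω.2.2.2))
      fun ω => (((N.trained h D' ω).1.1, (N.trained h D' ω).2.1), ω.2.2.2) := by
  have key := (N.holderDominated_run h hαβ init (κ := 2 * ((α - 1) / (2 * h.noiseScale ^ 2)))
    (s₀ := fun s => (N.data.diagonal s.1, N.mask.diagonal s.2))
    (((N.data.measurable_diagonal).comp measurable_fst).prodMk
      ((N.mask.measurable_diagonal).comp measurable_snd))
    (A := fun π e w s => (N.dataStep h false D D' π e w.1 s.1, N.maskStep h false D D' π e w.2 s.2))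
    (B := fun π e w s => (N.dataStep h true D D' π e w.1 s.1, N.maskStep h true D D' π e w.2 s.2))
    (N.measurable_dataStep_maskStep h D D' false) (N.measurable_dataStep_maskStep h D D' true)
    (fun π e s => by
      have := HolderDominated.prodMap hαβ.symm.pos
        ((N.data.measurable_coupledStep h _ _ _ false).comp measurable_prodMk_right)
        ((N.data.measurable_coupledStep h _ _ _ true).comp measurable_prodMk_right)
        ((N.mask.measurable_coupledStep h _ _ _ false).comp measurable_prodMk_right)
        ((N.mask.measurable_coupledStep h _ _ _ true).comp measurable_prodMk_right)
        (N.data.holderDominated_coupledStep h (h.interval ∣ e.2.1 + 1)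
          (fun b => (batchRow h.batch D (π e.1) e.2 b).filled)
          (fun b => (batchRow h.batch D' (π e.1) e.2 b).filled) hαβ hσ s.1)
        (N.mask.holderDominated_coupledStep h (h.interval ∣ e.2.1 + 1)
          (fun b => (batchRow h.batch D (π e.1) e.2 b).mask)
          (fun b => (batchRow h.batch D' (π e.1) e.2 b).mask) hαβ hσ s.2)
      refine this.mono (le_of_eq ?_)
      rw [← ENNReal.ofReal_mul (Real.exp_pos _).le, ← Real.exp_add]
      congr 2
      split_ifs <;> ring)).comp
    (g := fun p => ((p.1.1.1, p.1.2.1), p.2)) (by fun_prop)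
  have e1 := fun c (ω : N.Seed n h) =>
    congrArg (fun p => p.1.1) (N.side_foldl_dataStep_maskStep h D D' c ω.2.1 ω.2.2.1 ω.1)
  have e2 := fun c (ω : N.Seed n h) =>
    congrArg (fun p => p.2.1) (N.side_foldl_dataStep_maskStep h D D' c ω.2.1 ω.2.2.1 ω.1)
  simp only [GANPair.side, Prod.map] at e1 e2
  simpa only [e1, e2, trained, cond_false, cond_true] using key

theorem measurable_generate :
    Measurable fun p : Vec N.data.genDim × (Fin n → Vec N.data.latentDim) =>
      fun i => N.data.gen p.1 (p.2 i) :=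
  measurable_pi_lambda _ fun _ => N.data.measurable_gen (by fun_prop) (by fun_prop)

instance : IsProbabilityMeasure (N.seedLaw n h init) := by
  have : MeasurableSingletonClass (Equiv.Perm (Fin n)) := ⟨fun _ => trivial⟩
  unfold seedLaw; infer_instance

end MisGAN

/-! ### Comparison of the accumulated cost with R(α) -/

/-- The exponential does not depend on the summation index, and the binomial weights sum to 1. -/
theorem dpMisGANCost_eq (n : ℕ) (h : HyperParams) (α : ℕ) :
    dpMisGANCost n h α = 2 * (⌈(h.iterations n : ℝ) / (h.interval : ℝ)⌉₊ : ℝ) *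
      Real.exp (((α : ℝ) ^ 2 - α) / (8 * h.noiseScale ^ 2)) := by
  have hb : ∑ j ∈ Finset.range (α + 1),
      (α.choose j : ℝ) * (1 - (h.batch : ℝ) / n) ^ (α - j) * ((h.batch : ℝ) / n) ^ j = 1 := by
    have := add_pow ((h.batch : ℝ) / n) (1 - (h.batch : ℝ) / n) α
    rw [add_sub_cancel, one_pow] at this
    exact (Finset.sum_congr rfl fun j _ => by ring).trans this.symm
  rw [dpMisGANCost, ← Finset.sum_mul, hb, one_mul]

/-- The number of generator updates is at most `⌈T / T_G⌉`. -/
theorem generator_updates_le (n : ℕ) (h : HyperParams) (hTG : 0 < h.interval) :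
    h.epochs * (n / h.batch / h.interval) ≤ ⌈(h.iterations n : ℝ) / (h.interval : ℝ)⌉₊ := by
  have hT : (0 : ℝ) < h.interval := by exact_mod_cast hTG
  have h1 : h.epochs * (n / h.batch / h.interval) * h.interval ≤ h.iterations n := by
    rw [mul_assoc]
    exact Nat.mul_le_mul_left _ (Nat.div_mul_le_self _ _)
  have h2 : ((h.epochs * (n / h.batch / h.interval) : ℕ) : ℝ)
      ≤ (h.iterations n : ℝ) / (h.interval : ℝ) := by
    rw [le_div_iff₀ hT]
    exact_mod_cast h1
  exact_mod_cast h2.trans (Nat.le_ceil _)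

theorem two_mul_le_exp {y : ℝ} (hy : 0 ≤ y) : 2 * y ≤ Real.exp y := by
  linarith [Real.quadratic_le_exp_of_nonneg hy, sq_nonneg (y - 1), sq_nonneg y]

/-- If the generator updates of one iteration cost `c (α - 1) / (2σ²)` in the dual form and
`c ≤ α - 1`, then the total cost is at most `R(α)`. -/
theorem renyi_cost_le (n : ℕ) (h : HyperParams) (hTG : 0 < h.interval) (hσ : 0 < h.noiseScale)
    {α : ℕ} (hα : 2 ≤ α) {c : ℝ} (hc : c ≤ (α : ℝ) - 1) :
    1 / ((α : ℝ) - 1) * (α * ((h.epochs * (n / h.batch / h.interval) : ℕ) *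
      (c * (((α : ℝ) - 1) / (2 * h.noiseScale ^ 2))))) ≤ dpMisGANCost n h α := by
  have hα' : (2 : ℝ) ≤ α := by exact_mod_cast hα
  have h1 : (0 : ℝ) < α - 1 := by linarith
  set m := h.epochs * (n / h.batch / h.interval)
  have hm : (m : ℝ) ≤ (⌈(h.iterations n : ℝ) / (h.interval : ℝ)⌉₊ : ℝ) := by
    exact_mod_cast generator_updates_le n h hTG
  rw [dpMisGANCost_eq]
  set σ := h.noiseScale
  have hy0 : 0 ≤ ((α : ℝ) ^ 2 - α) / (8 * σ ^ 2) := div_nonneg (by nlinarith) (by positivity)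
  have hy := two_mul_le_exp hy0
  calc 1 / ((α : ℝ) - 1) * (α * (m * (c * (((α : ℝ) - 1) / (2 * σ ^ 2)))))
      = m * (c * α / (2 * σ ^ 2)) := by field_simp
    _ ≤ m * ((α - 1) * α / (2 * σ ^ 2)) := by gcongr
    -- With y the exponent in R(α), this is 4my, ready for 2y ≤ e^y.
    _ = 2 * m * (2 * (((α : ℝ) ^ 2 - α) / (8 * σ ^ 2))) := by field_simp; ring
    _ ≤ _ := mul_le_mul (by gcongr) hy (by linarith) (by positivity)

end

theorem mainTheorem5 {k : ℕ} (N : MisGAN k) (n : ℕ) (h : HyperParams)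
    (hB : 0 < h.batch) (hBn : h.batch ≤ n) (hTG : 0 < h.interval) (hσ : 0 < h.noiseScale)
    (init : MeasureTheory.Measure N.Params) [MeasureTheory.IsProbabilityMeasure init]
    (α : ℕ) (hα : 2 ≤ α) :
    IsRDP (N.dpMisGAN n h init) (α : ℝ) (dpMisGANCost n h α) ∧
      (3 ≤ α → IsRDP (N.dpMisGANGenerators n h init) (α : ℝ) (dpMisGANCost n h α)) := by
  have hconj : (α : ℝ).HolderConjugate (Real.conjExponent α) :=
    Real.HolderConjugate.conjExponent (by exact_mod_cast hα)
  have hg := N.measurable_generate (n := n)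
  have ht := fun D => N.measurable_trained h (n := n) D
  have hα' : (2 : ℝ) ≤ α := by exact_mod_cast hα
  refine ⟨fun D D' _ => ?_, fun hα3 D D' _ => ?_⟩
  · refine (HolderDominated.renyiDivergence_le hconj
      (hg.comp ((ht D).fst.fst.prodMk (ht D).snd)) (hg.comp ((ht D').fst.fst.prodMk (ht D').snd))
      ((N.holderDominated_data h D D' init hconj hσ).comp hg)).trans ?_
    rw [EReal.coe_le_coe_iff]
    simpa only [one_mul] using renyi_cost_le n h hTG hσ hα (c := 1) (by linarith)
  · have hp : Measurable fun p : (Vec N.data.genDim × Vec N.mask.genDim) ×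
        (Fin n → Vec N.data.latentDim) =>
        (p.1.1, p.1.2, fun i => N.data.gen p.1.1 (p.2 i)) :=
      measurable_fst.fst.prodMk (measurable_fst.snd.prodMk
        (hg.comp (measurable_fst.fst.prodMk measurable_snd)))
    refine (HolderDominated.renyiDivergence_le hconj (hp.comp (ht D)) (hp.comp (ht D'))
      ((N.holderDominated_data_mask h D D' init hconj hσ).comp hp)).trans ?_
    rw [EReal.coe_le_coe_iff]
    have : (3 : ℝ) ≤ α := by exact_mod_cast hα3
    -- Two generators are charged per update, so 2 ≤ α - 1 is needed.
    exact renyi_cost_le n h hTG hσ hα (c := 2) (by linarith)
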